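/- Let $d\ge 1$ and $m\ge 0$ be integers, let $1\le p<\infty$ and $\frac1p+\frac1q=1$. Let $\phi\in L^q(\mathbb R^d)$ be complex valued with $\int_{\mathbb R^d}\phi\,dx=1$ and bounded periodization, i.e. $P|\phi|(x):=\sum_{k\in\mathbb Z^d}|\phi(x-k)|$ belongs to $L^\infty(\mathbb R^d)$. Then there are constants $c,C\in(0,\infty)$, depending only on $d,m,p,\phi$, such that for every sequence $(\alpha_j)_{j>0}$ of nonzero real numbers with $|\alpha_j|\to\infty$ and every complex-valued $f\in W^{m,p}(\mathbb R^d)$, \[ c\,\|f\|_{W^{m,p}}\;\le\;\sup_{j>0}\sum_{|\rho|\le m}|\alpha_j|^{|\rho|}\,\bigl\|\Delta^\rho\{\langle f,\phi_{j,k}\rangle\}_{k\in\mathbb Z^d}\bigr\|_{\ell^p(\mathbb Z^d)}\;\le\;C\,\|f\|_{W^{m,p}} . \] Here $\phi_{j,k}(x)=|\alpha_j|^{d/q}\,\phi(\alpha_jx-k)$ (dilation matrices $a_j=\alpha_jI$, translation matrix $b=I$), $\langle f,g\rangle=\int_{\mathbb R^d}f\,\overline g\,dx$, the sums run over multiindices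 $\rho$, $\|f\|_{W^{m,p}}=\sum_{|\rho|\le m}\|D^\rho f\|_{L^p(\mathbb R^d)}$ with weak derivatives $D^\rho f$, and $\Delta^\rho=\Delta_1^{\rho_1}\cdots\Delta_d^{\rho_d}$ with $(\Delta_ts)_k=s_k-s_{k-e_t}$. -/

import Mathlib

open MeasureTheory Filter Topology
open scoped ENNReal NNReal ContDiff

noncomputable section

namespace AffineAnalysis

/-- Multiindices `ρ = (ρ₁, …, ρ_d)` of order `|ρ| = ρ₁ + ⋯ + ρ_d ≤ m`. -/
def multiIndices (d m : ℕ) : Finset (Fin d → ℕ) :=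
  {ρ ∈ Fintype.piFinset fun _ => Finset.range (m + 1) | ∑ t, ρ t ≤ m}

/-- For operators `T₁, …, T_d`, the composition `T^ρ = T₁^{ρ₁} ⋯ T_d^{ρ_d}`. -/
def multiPow {d : ℕ} {X : Type*} (T : Fin d → X → X) (ρ : Fin d → ℕ) (x : X) : X :=
  (List.finRange d).foldr (fun t y => (T t)^[ρ t] y) x

/-- The classical partial derivative in the `t`-th coordinate direction. -/
def partialDeriv {d : ℕ} (t : Fin d) (g : EuclideanSpace ℝ (Fin d) → ℝ) :
    EuclideanSpace ℝ (Fin d) → ℝ :=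
  fun x => fderiv ℝ g x (EuclideanSpace.single t 1)

/-- `g` is a `ρ`-th weak derivative of `f` on `ℝ^d` (for `f` and `g` locally integrable):
`∫ f D^ρ u = (-1)^{|ρ|} ∫ g u` for all test functions `u`. Real test functions suffice,
since both sides are linear in `u`. -/
def HasWeakDeriv {d : ℕ} (ρ : Fin d → ℕ) (f g : EuclideanSpace ℝ (Fin d) → ℂ) : Prop :=
  ∀ u : EuclideanSpace ℝ (Fin d) → ℝ, ContDiff ℝ ∞ u → HasCompactSupport u →
    ∫ x, multiPow partialDeriv ρ u x • f x = (-1 : ℝ) ^ (∑ t, ρ t) • ∫ x, u x • g x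

/-- Membership in the Sobolev space `W^{m,p}(ℝ^d)`. -/
def MemSobolev {d : ℕ} (m : ℕ) (p : ℝ≥0∞) (f : EuclideanSpace ℝ (Fin d) → ℂ) : Prop :=
  MemLp f p volume ∧
    ∀ ρ ∈ multiIndices d m, ∃ g, MemLp g p volume ∧ HasWeakDeriv ρ f g

open Classical in
/-- The weak derivative `D^ρ f`, unique up to almost everywhere equality when it exists as
a locally integrable function. -/
def weakDeriv {d : ℕ} (ρ : Fin d → ℕ) (f : EuclideanSpace ℝ (Fin d) → ℂ) :
    EuclideanSpace ℝ (Fin d) → ℂ :=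
  if h : ∃ g, LocallyIntegrable g volume ∧ HasWeakDeriv ρ f g then h.choose else 0

/-- `‖f‖_{W^{m,p}} = ∑_{|ρ| ≤ m} ‖D^ρ f‖_p`, for `f` in `W^{m,p}`. -/
def sobolevNorm {d : ℕ} (m : ℕ) (p : ℝ≥0∞) (f : EuclideanSpace ℝ (Fin d) → ℂ) : ℝ≥0∞ :=
  ∑ ρ ∈ multiIndices d m, eLpNorm (weakDeriv ρ f) p volume

/-- The point of `ℝ^d` with integer coordinates `k`. -/
def latticePoint {d : ℕ} (k : Fin d → ℤ) : EuclideanSpace ℝ (Fin d) :=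
  WithLp.toLp 2 fun t => (k t : ℝ)

/-- The periodization `P|φ|(x) = ∑_k |φ(x - k)|` over the lattice `ℤ^d`, with values in
`[0, ∞]`. -/
def periodizationAbs {d : ℕ} (φ : EuclideanSpace ℝ (Fin d) → ℂ) :
    EuclideanSpace ℝ (Fin d) → ℝ≥0∞ :=
  fun x => ∑' k : Fin d → ℤ, ‖φ (x - latticePoint k)‖ₑ

/-- The rescaling `|det a|^{1/q} φ(a x - k)` for the isotropic dilation `a = α I`, where
`|det a| = |α|^d`. -/
def rescale {d : ℕ} (q : ℝ≥0∞) (φ : EuclideanSpace ℝ (Fin d) → ℂ) (α : ℝ) (k : Fin d → ℤ) :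
    EuclideanSpace ℝ (Fin d) → ℂ :=
  fun x => ((|α| ^ d) ^ (1 / q).toReal : ℝ) • φ (α • x - latticePoint k)

/-- The analysis operator for the dilation `α I`: the sequence of pairings
`∫ f(x) conj(φ_{α,k}(x)) dx`, indexed by `k ∈ ℤ^d`. -/
def analysis {d : ℕ} (q : ℝ≥0∞) (φ : EuclideanSpace ℝ (Fin d) → ℂ) (α : ℝ)
    (f : EuclideanSpace ℝ (Fin d) → ℂ) : (Fin d → ℤ) → ℂ :=
  fun k => ∫ x, f x * (starRingEnd ℂ) (rescale q φ α k x)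

/-- The backward difference `(Δ_t s)_k = s_k - s_{k - e_t}`. -/
def diffOp {d : ℕ} (t : Fin d) (s : (Fin d → ℤ) → ℂ) : (Fin d → ℤ) → ℂ :=
  fun k => s k - s (k - Pi.single t 1)

/-- The `ℓ^p` norm over `ℤ^d`, for `1 ≤ p < ∞`, with values in `[0, ∞]`. -/
def seqNorm {d : ℕ} (p : ℝ≥0∞) (s : (Fin d → ℤ) → ℂ) : ℝ≥0∞ :=
  (∑' k, ‖s k‖ₑ ^ p.toReal) ^ (1 / p.toReal)

/-- The norm `sup_{j>0} ∑_{|ρ| ≤ m} |α_j|^{|ρ|} ‖Δ^ρ c_j‖_{ℓ^p}` of a doubly indexed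
sequence `c = {c_{j,k}}`. -/
def discreteSobolevNorm {d : ℕ} (m : ℕ) (p : ℝ≥0∞) (α : ℕ → ℝ)
    (c : ℕ → (Fin d → ℤ) → ℂ) : ℝ≥0∞ :=
  ⨆ (j : ℕ) (_ : 0 < j), ∑ ρ ∈ multiIndices d m,
    ‖α j‖ₑ ^ (∑ t, ρ t) * seqNorm p (multiPow diffOp ρ (c j))

end AffineAnalysis

end

/-! Let `T_α` denote the analysis operator. Replacing `k` by `k - e_t` amounts to translating `f` by
`α⁻¹ e_t`, so `Δ^ρ T_α f` is `T_α` applied to an iterated difference of `f` with step `α⁻¹`. By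
duality with the fundamental theorem of calculus for test functions, that difference is `α^{-|ρ|}`
times an average `G_α` of translates of `D^ρ f`, taken against a probability measure carried by the
ball of radius `|ρ|/|α|` (`exists_backDiff_ae_eq_average`). Hence `|α|^{|ρ|} ‖Δ^ρ T_α f‖ = ‖T_α
G_α‖` exactly (`exists_scaled_diff_analysis_eq`), and everything reduces to `T_α` on `L^p`.

Upper bound: averaging does not increase the `L^p` norm, and `T_α : L^p → ℓ^p` is bounded uniformly
in `α` by Jensen's inequality and the bounded periodization (`seqNorm_analysis_le`).

Lower bound: `G_{α_j} → D^ρ f` in `L^p` by continuity of translations. For continuous compactly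
supported `g`, `‖T_α g‖` is the `L^p` norm of a step function on the cells of `α⁻¹ ℤ^d`; as `|α| →
∞` these step functions tend pointwise to `g` because `∫ φ = 1`, and Fatou's lemma gives `‖g‖_p ≤
liminf ‖T_{α_j} g‖`. Density and the uniform bound extend this to convergent sequences in `L^p`
(`eventually_eLpNorm_le_seqNorm_analysis_add`). There are finitely many `ρ`, so a single large `j`
serves all of them, and `c = 1` works. -/

namespace AffineAnalysis

/-! ### Differences of test functions as averages of derivatives. -/

variable {d : ℕ}

/-- The list of coordinate directions in which each `t` occurs `ρ t` times. -/
def coordList (ρ : Fin d → ℕ) : List (Fin d) :=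
  (List.finRange d).flatMap fun t => List.replicate (ρ t) t

lemma length_coordList (ρ : Fin d → ℕ) : (coordList ρ).length = ∑ t, ρ t := by
  simp [coordList, List.length_flatMap, Fin.sum_univ_def]

lemma foldr_replicate_eq_iterate {X ι : Type*} (T : ι → X → X) (t : ι) (n : ℕ) (x : X) :
    (List.replicate n t).foldr T x = (T t)^[n] x := by
  induction n with
  | zero => rfl
  | succ n ih => rw [List.replicate_succ, List.foldr_cons, ih, Function.iterate_succ_apply']

lemma multiPow_eq_foldr {X : Type*} (T : Fin d → X → X) (ρ : Fin d → ℕ) (x : X) :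
    multiPow T ρ x = (coordList ρ).foldr T x := by
  simp only [multiPow, coordList, List.foldr_flatMap, foldr_replicate_eq_iterate]

/-- The backward difference with step `h` in the `t`-th coordinate direction. -/
noncomputable def backDiff {F : Type*} [Sub F] (h : ℝ) (t : Fin d) (f : EuclideanSpace ℝ (Fin d) → F) :
    EuclideanSpace ℝ (Fin d) → F :=
  fun x => f x - f (x - h • EuclideanSpace.single t 1)

section TestFunctions

variable {u : EuclideanSpace ℝ (Fin d) → ℝ}

lemma contDiff_partialDeriv (t : Fin d) (hu : ContDiff ℝ ∞ u) :
    ContDiff ℝ ∞ (partialDeriv t u) :=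
  (hu.fderiv_right (m := ∞) (by simp)).clm_apply contDiff_const

lemma contDiff_foldr_partialDeriv (hu : ContDiff ℝ ∞ u) (l : List (Fin d)) :
    ContDiff ℝ ∞ (l.foldr partialDeriv u) := by
  induction l with
  | nil => exact hu
  | cons t l ih => exact contDiff_partialDeriv t ih

lemma hasCompactSupport_foldr_partialDeriv (hu : HasCompactSupport u) (l : List (Fin d)) :
    HasCompactSupport (l.foldr partialDeriv u) := by
  induction l with
  | nil => exact hu
  | cons t l ih => exact ih.fderiv_apply ℝ _

lemma contDiff_backDiff (h : ℝ) (t : Fin d) (hu : ContDiff ℝ ∞ u) :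
    ContDiff ℝ ∞ (backDiff h t u) :=
  hu.sub (hu.comp (contDiff_id.sub contDiff_const))

lemma HasCompactSupport.comp_sub_const {F : Type*} [Zero F] {v : EuclideanSpace ℝ (Fin d) → F}
    (hv : HasCompactSupport v) (y : EuclideanSpace ℝ (Fin d)) :
    HasCompactSupport fun x => v (x - y) :=
  hv.comp_homeomorph (Homeomorph.subRight y)

lemma hasCompactSupport_backDiff (h : ℝ) (t : Fin d) (hu : HasCompactSupport u) :
    HasCompactSupport (backDiff h t u) :=
  hu.sub (HasCompactSupport.comp_sub_const hu _)

lemma partialDeriv_comp_sub (t : Fin d) (y : EuclideanSpace ℝ (Fin d)) :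
    partialDeriv t (fun x => u (x - y)) = fun x => partialDeriv t u (x - y) := by
  funext x
  simp only [partialDeriv, fderiv_comp_sub]

lemma foldr_partialDeriv_comp_sub (l : List (Fin d)) (y : EuclideanSpace ℝ (Fin d)) :
    l.foldr partialDeriv (fun x => u (x - y)) = fun x => l.foldr partialDeriv u (x - y) := by
  induction l with
  | nil => rfl
  | cons t l ih => rw [List.foldr_cons, ih, partialDeriv_comp_sub]; rfl

lemma partialDeriv_backDiff (h : ℝ) (s t : Fin d) (hu : ContDiff ℝ ∞ u) :
    partialDeriv s (backDiff h t u) = backDiff h t (partialDeriv s u) := by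
  funext x
  have hd : Differentiable ℝ u := hu.differentiable (by simp)
  have h1 : DifferentiableAt ℝ (fun x => u (x - h • EuclideanSpace.single t 1)) x :=
    (hd _).comp x (differentiableAt_id.sub_const _)
  have h2 : fderiv ℝ (backDiff h t u) x = _ := fderiv_fun_sub (hd x) h1
  simp only [partialDeriv, h2, fderiv_comp_sub]
  rfl

lemma foldr_partialDeriv_backDiff (h : ℝ) (t : Fin d) (hu : ContDiff ℝ ∞ u) (l : List (Fin d)) :
    l.foldr partialDeriv (backDiff h t u) = backDiff h t (l.foldr partialDeriv u) := by
  induction l with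
  | nil => rfl
  | cons s l ih =>
    rw [List.foldr_cons, ih, partialDeriv_backDiff h s t (contDiff_foldr_partialDeriv hu l)]
    rfl

/-- The fundamental theorem of calculus along the segment from `x` to `x - h e_t`, parametrized by
`[0, 1]` so that the integral is an average. -/
lemma backDiff_eq_integral (h : ℝ) (t : Fin d) (hu : ContDiff ℝ ∞ u)
    (x : EuclideanSpace ℝ (Fin d)) :
    backDiff h t u x =
      h * ∫ s in (0 : ℝ)..1, partialDeriv t u (x - (s * h) • EuclideanSpace.single t 1) := by
  have hd : Differentiable ℝ u := hu.differentiable (by simp)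
  have hder : ∀ s ∈ Set.uIcc (0 : ℝ) 1,
      HasDerivAt (fun s : ℝ => u (x - (s * h) • EuclideanSpace.single t 1))
        (-h * partialDeriv t u (x - (s * h) • EuclideanSpace.single t 1)) s := by
    intro s _
    have h1 : HasDerivAt (fun s : ℝ => x - (s * h) • EuclideanSpace.single t (1 : ℝ))
        (-(h • EuclideanSpace.single t (1 : ℝ))) s := by
      simpa using (((hasDerivAt_id s).mul_const h).smul_const
        (EuclideanSpace.single t (1 : ℝ))).const_sub x
    have h2 := (hd (x - (s * h) • EuclideanSpace.single t 1)).hasFDerivAt.comp_hasDerivAt s h1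
    convert! h2 using 1
    simp [partialDeriv]
  have hc : Continuous fun s : ℝ =>
      -h * partialDeriv t u (x - (s * h) • EuclideanSpace.single t 1) := by
    have := (contDiff_partialDeriv t hu).continuous
    fun_prop
  have := intervalIntegral.integral_eq_sub_of_hasDerivAt hder (hc.intervalIntegrable _ _)
  rw [intervalIntegral.integral_const_mul] at this
  simp only [zero_mul, zero_smul, sub_zero, one_mul] at this
  rw [backDiff]
  linarith

end TestFunctions

/-- Iterated differences of a test function are averages of its iterated derivatives. -/
lemma exists_foldl_backDiff_eq_integral (h : ℝ) (l : List (Fin d)) :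
    ∃ μ : Measure (EuclideanSpace ℝ (Fin d)), IsProbabilityMeasure μ ∧
      (∀ᵐ y ∂μ, ‖y‖ ≤ l.length * |h|) ∧
      ∀ u : EuclideanSpace ℝ (Fin d) → ℝ, ContDiff ℝ ∞ u → HasCompactSupport u → ∀ x,
        l.foldl (fun v t => backDiff h t v) u x =
          h ^ l.length * ∫ y, l.foldr partialDeriv u (x - y) ∂μ := by
  induction l with
  | nil =>
    refine ⟨Measure.dirac 0, inferInstance, ?_, fun u hu hc x => ?_⟩
    · rw [ae_dirac_eq]; simp
    · simp
  | cons t l ih =>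
    obtain ⟨μ, hμ, hsupp, hform⟩ := ih
    let σ : Measure ℝ := volume.restrict (Set.Ioc 0 1)
    have hσ : IsProbabilityMeasure σ := ⟨by simp [σ]⟩
    let S : EuclideanSpace ℝ (Fin d) × ℝ → EuclideanSpace ℝ (Fin d) :=
      fun z => z.1 + (z.2 * h) • EuclideanSpace.single t 1
    have hSc : Continuous S := by fun_prop
    -- The new measure is the convolution of `μ` with the uniform law on the segment from `0` to `h
    -- e_t`. Its mass stays one and the radius of its support grows by at most `|h|`.
    refine ⟨(μ.prod σ).map S, Measure.isProbabilityMeasure_map hSc.aemeasurable, ?_,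
      fun u hu hc x => ?_⟩
    · rw [ae_map_iff hSc.aemeasurable (measurableSet_le (by fun_prop) (by fun_prop))]
      have h1 : ∀ᵐ z ∂(μ.prod σ), ‖z.1‖ ≤ l.length * |h| :=
        Measure.quasiMeasurePreserving_fst.ae hsupp
      have h2 : ∀ᵐ z ∂(μ.prod σ), z.2 ∈ Set.Ioc (0 : ℝ) 1 :=
        Measure.quasiMeasurePreserving_snd.ae (ae_restrict_mem measurableSet_Ioc)
      filter_upwards [h1, h2] with z hz1 hz2
      refine (norm_add_le _ _).trans ?_
      have : ‖(z.2 * h) • EuclideanSpace.single t (1 : ℝ)‖ ≤ |h| := by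
        rw [norm_smul, PiLp.norm_single, norm_one, mul_one, norm_mul, Real.norm_eq_abs,
          Real.norm_eq_abs, abs_of_pos hz2.1]
        exact mul_le_of_le_one_left (abs_nonneg _) hz2.2
      simp only [List.length_cons, Nat.cast_add, Nat.cast_one]
      linarith
    · rw [List.foldl_cons, hform _ (contDiff_backDiff h t hu) (hasCompactSupport_backDiff h t hc),
        foldr_partialDeriv_backDiff h t hu, List.foldr_cons]
      have hw := contDiff_foldr_partialDeriv hu l
      have hwc := hasCompactSupport_foldr_partialDeriv hc l
      set w := l.foldr partialDeriv u
      have hcont : Continuous (partialDeriv t w) := (contDiff_partialDeriv t hw).continuous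
      obtain ⟨M, hM⟩ := hcont.bounded_above_of_compact_support (hwc.fderiv_apply ℝ _)
      rw [integral_map hSc.aemeasurable (by fun_prop), integral_prod]
      · simp only [backDiff_eq_integral h t hw, integral_const_mul, List.length_cons, pow_succ,
          mul_assoc, S, σ, intervalIntegral.integral_of_le zero_le_one, sub_add_eq_sub_sub]
      · exact Integrable.of_bound (C := M) (by fun_prop) (ae_of_all _ fun z => hM _)

end AffineAnalysis

/-! ### Averages of translates in `L^p` and weak derivatives. -/

namespace AffineAnalysis

/-- Jensen's inequality for powers with respect to a finite measure. -/
lemma rpow_lintegral_le {α : Type*} [MeasurableSpace α] (ν : Measure α) [IsFiniteMeasure ν]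
    {r : ℝ} (hr : 1 ≤ r) {a : α → ℝ≥0∞} (ha : AEMeasurable a ν) :
    (∫⁻ x, a x ∂ν) ^ r ≤ ν Set.univ ^ (r - 1) * ∫⁻ x, a x ^ r ∂ν := by
  have hr0 : 0 < r := by linarith
  have hp : (1 : ℝ≥0∞) ≤ ENNReal.ofReal r := by simpa using hr
  have h := eLpNorm_le_eLpNorm_mul_rpow_measure_univ (f := a) hp ha.aestronglyMeasurable
  rw [eLpNorm_one_eq_lintegral_enorm, eLpNorm_eq_lintegral_rpow_enorm_toReal
    (by simpa using hr0) ENNReal.ofReal_ne_top, ENNReal.toReal_ofReal hr0.le] at h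
  simp only [enorm_eq_self, ENNReal.toReal_one, div_one] at h
  refine (ENNReal.rpow_le_rpow h hr0.le).trans_eq ?_
  rw [ENNReal.mul_rpow_of_nonneg _ _ hr0.le, ← ENNReal.rpow_mul, ← ENNReal.rpow_mul,
    one_div_mul_cancel hr0.ne', ENNReal.rpow_one, mul_comm]
  congr 2
  field_simp

variable {d : ℕ}

lemma MemLp.comp_sub_const {F : Type*} [NormedAddCommGroup F] {p : ℝ≥0∞}
    {f : EuclideanSpace ℝ (Fin d) → F} (hf : MemLp f p volume) (y : EuclideanSpace ℝ (Fin d)) :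
    MemLp (fun x => f (x - y)) p volume :=
  hf.comp_measurePreserving (measurePreserving_sub_right volume y)

lemma MemLp.backDiff {F : Type*} [NormedAddCommGroup F] {p : ℝ≥0∞}
    {f : EuclideanSpace ℝ (Fin d) → F} (hf : MemLp f p volume) (h : ℝ) (t : Fin d) :
    MemLp (backDiff h t f) p volume :=
  hf.sub (MemLp.comp_sub_const hf _)

lemma MemLp.foldr_backDiff {F : Type*} [NormedAddCommGroup F] {p : ℝ≥0∞}
    {f : EuclideanSpace ℝ (Fin d) → F} (hf : MemLp f p volume) (h : ℝ) (l : List (Fin d)) :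
    MemLp (l.foldr (AffineAnalysis.backDiff h) f) p volume := by
  induction l with
  | nil => exact hf
  | cons t l ih => exact MemLp.backDiff ih h t

/-- Summation by parts: the adjoint of the difference with step `h` is the difference with step
`-h`. Adjoints reverse the order of composition, hence `foldr` on one side and `foldl` on the other.
-/
lemma integral_smul_foldr_backDiff {p : ℝ≥0∞} (hp : 1 ≤ p)
    {f : EuclideanSpace ℝ (Fin d) → ℂ} (hf : MemLp f p volume) (h : ℝ) (l : List (Fin d))
    {u : EuclideanSpace ℝ (Fin d) → ℝ} (hu : ContDiff ℝ ∞ u) (hc : HasCompactSupport u) :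
    ∫ x, u x • l.foldr (backDiff h) f x =
      ∫ x, l.foldl (fun v t => backDiff (-h) t v) u x • f x := by
  induction l generalizing u with
  | nil => rfl
  | cons t l ih =>
    rw [List.foldl_cons, ← ih (contDiff_backDiff _ t hu) (hasCompactSupport_backDiff _ t hc),
      List.foldr_cons]
    have hw := MemLp.foldr_backDiff hf h l
    set w := l.foldr (backDiff h) f
    set e := h • EuclideanSpace.single t (1 : ℝ)
    have key : ∀ v : EuclideanSpace ℝ (Fin d) → ℂ, MemLp v p volume →
        ∀ {u' : EuclideanSpace ℝ (Fin d) → ℝ}, Continuous u' → HasCompactSupport u' →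
        Integrable fun x => u' x • v x := fun v hv u' hu' hc' =>
      (hv.locallyIntegrable hp).integrable_smul_left_of_hasCompactSupport hu' hc'
    have hu2 : Continuous fun x => u (x - -e) := by
      have := hu.continuous
      fun_prop
    calc ∫ x, u x • backDiff h t w x
        = ∫ x, (u x • w x - u x • w (x - e)) := by simp only [backDiff, smul_sub, e]
      _ = (∫ x, u x • w x) - ∫ x, u x • w (x - e) :=
          integral_sub (key w hw hu.continuous hc)
            (key _ (MemLp.comp_sub_const hw e) hu.continuous hc)
      _ = (∫ x, u x • w x) - ∫ x, u (x - -e) • w x := by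
          rw [← integral_sub_right_eq_self (fun x => u (x - -e) • w x) e]
          simp
      _ = ∫ x, (u x • w x - u (x - -e) • w x) :=
          (integral_sub (key w hw hu.continuous hc)
            (key w hw hu2 (HasCompactSupport.comp_sub_const hc _))).symm
      _ = _ := by simp only [backDiff, sub_smul, neg_smul, e]

section Average

variable {μ : Measure (EuclideanSpace ℝ (Fin d))} [IsProbabilityMeasure μ]

/-- Minkowski's integral inequality with respect to a probability measure. -/
lemma lintegral_rpow_lintegral_le {r : ℝ} (hr : 1 ≤ r)
    {K : EuclideanSpace ℝ (Fin d) → EuclideanSpace ℝ (Fin d) → ℝ≥0∞}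
    (hK : Measurable (Function.uncurry K)) {B : ℝ≥0∞}
    (hB : ∀ᵐ y ∂μ, ∫⁻ x, K x y ^ r ≤ B) :
    ∫⁻ x, (∫⁻ y, K x y ∂μ) ^ r ≤ B := by
  calc ∫⁻ x, (∫⁻ y, K x y ∂μ) ^ r
      ≤ ∫⁻ x, (∫⁻ y, K x y ^ r ∂μ) := by
        refine lintegral_mono fun x => ?_
        have := rpow_lintegral_le μ hr (a := K x) (hK.comp measurable_prodMk_left).aemeasurable
        simpa using this
    _ = ∫⁻ y, (∫⁻ x, K x y ^ r) ∂μ := lintegral_lintegral_swap (hK.pow_const r).aemeasurable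
    _ ≤ ∫⁻ _, B ∂μ := lintegral_mono_ae hB
    _ = B := by simp

variable {p : ℝ≥0∞} {G : Type*} [NormedAddCommGroup G] [NormedSpace ℝ G]
  {g : EuclideanSpace ℝ (Fin d) → G}

lemma eLpNorm_rpow_toReal {α F : Type*} [MeasurableSpace α] [ENorm F] {ν : Measure α}
    (hp : 1 ≤ p) (hp_top : p ≠ ⊤) (f : α → F) :
    eLpNorm f p ν ^ p.toReal = ∫⁻ x, ‖f x‖ₑ ^ p.toReal ∂ν := by
  have hp0 : p ≠ 0 := (zero_lt_one.trans_le hp).ne'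
  have h0 : p.toReal ≠ 0 := (ENNReal.toReal_pos hp0 hp_top).ne'
  rw [eLpNorm_eq_lintegral_rpow_enorm_toReal hp0 hp_top, ← ENNReal.rpow_mul,
    one_div_mul_cancel h0, ENNReal.rpow_one]

lemma one_le_toReal (hp : 1 ≤ p) (hp_top : p ≠ ⊤) : 1 ≤ p.toReal := by
  simpa using ENNReal.toReal_mono hp_top hp

lemma eLpNorm_le_of_lintegral_rpow_le {α F : Type*} [MeasurableSpace α] [ENorm F]
    {ν : Measure α} (hp : 1 ≤ p) (hp_top : p ≠ ⊤) {f : α → F} {B : ℝ≥0∞}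
    (h : ∫⁻ x, ‖f x‖ₑ ^ p.toReal ∂ν ≤ B ^ p.toReal) : eLpNorm f p ν ≤ B := by
  rw [← eLpNorm_rpow_toReal hp hp_top] at h
  exact (ENNReal.rpow_le_rpow_iff (zero_lt_one.trans_le (one_le_toReal hp hp_top))).1 h

lemma eLpNorm_comp_add {F : Type*} [NormedAddCommGroup F] {g : EuclideanSpace ℝ (Fin d) → F}
    (hg : AEStronglyMeasurable g volume) (y : EuclideanSpace ℝ (Fin d)) :
    eLpNorm (fun x => g (x + y)) p volume = eLpNorm g p volume :=
  eLpNorm_comp_measurePreserving hg (measurePreserving_add_right volume y)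

lemma lintegral_rpow_lintegral_comp_add_le {F : Type*} [NormedAddCommGroup F]
    {g : EuclideanSpace ℝ (Fin d) → F} (hp : 1 ≤ p) (hp_top : p ≠ ⊤)
    (hg : StronglyMeasurable g) :
    ∫⁻ x, (∫⁻ y, ‖g (x + y)‖ₑ ∂μ) ^ p.toReal ≤ eLpNorm g p volume ^ p.toReal := by
  refine lintegral_rpow_lintegral_le (one_le_toReal hp hp_top)
    (K := fun x y => ‖g (x + y)‖ₑ) (hg.enorm.comp measurable_add)
    (ae_of_all _ fun y => ?_)
  rw [← eLpNorm_comp_add hg.aestronglyMeasurable y, eLpNorm_rpow_toReal hp hp_top]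

lemma stronglyMeasurable_average (hg : StronglyMeasurable g) :
    StronglyMeasurable fun x => ∫ y, g (x + y) ∂μ :=
  StronglyMeasurable.integral_prod_right'
    (f := fun z : EuclideanSpace ℝ (Fin d) × EuclideanSpace ℝ (Fin d) => g (z.1 + z.2))
    (hg.comp_measurable (by fun_prop))

lemma memLp_average (hp : 1 ≤ p) (hp_top : p ≠ ⊤) (hg : StronglyMeasurable g)
    (hgp : MemLp g p volume) :
    MemLp (fun x => ∫ y, g (x + y) ∂μ) p volume ∧
      eLpNorm (fun x => ∫ y, g (x + y) ∂μ) p volume ≤ eLpNorm g p volume := by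
  have h : eLpNorm (fun x => ∫ y, g (x + y) ∂μ) p volume ≤ eLpNorm g p volume := by
    refine eLpNorm_le_of_lintegral_rpow_le hp hp_top ?_
    refine le_trans (lintegral_mono fun x => ?_)
      (lintegral_rpow_lintegral_comp_add_le (μ := μ) hp hp_top hg)
    exact ENNReal.rpow_le_rpow (enorm_integral_le_lintegral_enorm _) ENNReal.toReal_nonneg
  exact ⟨⟨(stronglyMeasurable_average hg).aestronglyMeasurable, h.trans_lt hgp.2⟩, h⟩

/-- Minkowski's inequality makes the `p`-th power of the inner integral integrable in `x`, so that
inner integral is finite almost everywhere. -/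
lemma ae_integrable_comp_add {F : Type*} [NormedAddCommGroup F]
    {g : EuclideanSpace ℝ (Fin d) → F} (hp : 1 ≤ p) (hp_top : p ≠ ⊤) (hg : StronglyMeasurable g)
    (hgp : MemLp g p volume) : ∀ᵐ x, Integrable (fun y => g (x + y)) μ := by
  have hp0 : 0 < p.toReal := zero_lt_one.trans_le (one_le_toReal hp hp_top)
  have hm : Measurable fun x => ∫⁻ y, ‖g (x + y)‖ₑ ∂μ :=
    Measurable.lintegral_prod_right'
      (f := fun z : EuclideanSpace ℝ (Fin d) × EuclideanSpace ℝ (Fin d) => ‖g (z.1 + z.2)‖ₑ)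
      (hg.enorm.comp measurable_add)
  have hlt := (lintegral_rpow_lintegral_comp_add_le (μ := μ) hp hp_top hg).trans_lt
    (ENNReal.rpow_lt_top_of_nonneg hp0.le hgp.2.ne)
  filter_upwards [ae_lt_top (hm.pow_const _) hlt.ne] with x hx
  refine ⟨(hg.comp_measurable (by fun_prop)).aestronglyMeasurable, ?_⟩
  rwa [ENNReal.rpow_lt_top_iff_of_pos hp0] at hx

/-- As `μ` has mass one, `g x` can be moved inside the average; Minkowski's inequality then applies
to `g (x + y) - g x`. -/
lemma eLpNorm_average_sub_le [CompleteSpace G] (hp : 1 ≤ p) (hp_top : p ≠ ⊤) (hg : StronglyMeasurable g)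
    (hgp : MemLp g p volume) {B : ℝ≥0∞}
    (hB : ∀ᵐ y ∂μ, eLpNorm (fun x => g (x + y) - g x) p volume ≤ B) :
    eLpNorm (fun x => ∫ y, g (x + y) ∂μ - g x) p volume ≤ B := by
  have hp0 : 0 < p.toReal := zero_lt_one.trans_le (one_le_toReal hp hp_top)
  refine eLpNorm_le_of_lintegral_rpow_le hp hp_top ?_
  refine le_trans (lintegral_mono_ae ?_) (lintegral_rpow_lintegral_le (μ := μ)
    (one_le_toReal hp hp_top) (K := fun x y => ‖g (x + y) - g x‖ₑ)
    ((hg.comp_measurable measurable_add).sub (hg.comp_measurable measurable_fst)).enorm ?_)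
  · filter_upwards [ae_integrable_comp_add (μ := μ) hp hp_top hg hgp] with x hx
    have : ∫ y, g (x + y) ∂μ - g x = ∫ y, (g (x + y) - g x) ∂μ := by
      rw [integral_sub hx (integrable_const _)]; simp
    rw [this]
    exact ENNReal.rpow_le_rpow (enorm_integral_le_lintegral_enorm _) hp0.le
  · filter_upwards [hB] with y hy
    rw [← eLpNorm_rpow_toReal hp hp_top]
    exact ENNReal.rpow_le_rpow hy hp0.le

end Average

lemma HasWeakDeriv.congr_ae {ρ : Fin d → ℕ} {f g g' : EuclideanSpace ℝ (Fin d) → ℂ}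
    (h : HasWeakDeriv ρ f g) (hg : g =ᵐ[volume] g') : HasWeakDeriv ρ f g' := by
  intro u hu hc
  rw [h u hu hc]
  congr 1
  refine integral_congr_ae ?_
  filter_upwards [hg] with x hx
  rw [hx]

/-- Integrability of `u (x - y) • f x` for `y` in a bounded set. -/
lemma integrable_prod_smul_comp_sub {p : ℝ≥0∞} (hp : 1 ≤ p)
    {f : EuclideanSpace ℝ (Fin d) → ℂ} (hf : MemLp f p volume)
    {u : EuclideanSpace ℝ (Fin d) → ℝ} (hu : Continuous u) (hc : HasCompactSupport u)
    {μ : Measure (EuclideanSpace ℝ (Fin d))} [IsProbabilityMeasure μ] {R : ℝ}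
    (hμ : ∀ᵐ y ∂μ, ‖y‖ ≤ R) :
    Integrable (Function.uncurry fun x y => u (x - y) • f x) (volume.prod μ) := by
  obtain ⟨M, hM⟩ := hu.bounded_above_of_compact_support hc
  obtain ⟨R', hR'⟩ := hc.isCompact.isBounded.subset_closedBall 0
  -- With `u` supported in the ball of radius `R'` and `‖y‖ ≤ R`, the integrand vanishes unless `‖x‖
  -- ≤ R' + R`; it is dominated by `M |f|` on that ball.
  have hfi : IntegrableOn f (Metric.closedBall 0 (R' + R)) volume :=
    (hf.locallyIntegrable hp).integrableOn_isCompact (isCompact_closedBall _ _)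
  have h1 : Integrable (fun x => (Metric.closedBall 0 (R' + R)).indicator f x) volume :=
    hfi.integrable_indicator Metric.isClosed_closedBall.measurableSet
  have h2 : Integrable (fun z : EuclideanSpace ℝ (Fin d) × EuclideanSpace ℝ (Fin d) =>
      (Metric.closedBall 0 (R' + R)).indicator f z.1) (volume.prod μ) := h1.comp_fst μ
  refine (h2.norm.const_mul M).mono' ?_ ?_
  · have hfm : AEStronglyMeasurable (fun z : EuclideanSpace ℝ (Fin d) ×
        EuclideanSpace ℝ (Fin d) => f z.1) (volume.prod μ) := hf.1.comp_fst
    have : AEStronglyMeasurable (fun z : EuclideanSpace ℝ (Fin d) × EuclideanSpace ℝ (Fin d) =>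
        u (z.1 - z.2)) (volume.prod μ) :=
      (hu.comp (continuous_fst.sub continuous_snd)).aestronglyMeasurable
    exact this.smul hfm
  · have h3 : ∀ᵐ z ∂((volume : Measure (EuclideanSpace ℝ (Fin d))).prod μ), ‖z.2‖ ≤ R :=
      Measure.quasiMeasurePreserving_snd.ae hμ
    filter_upwards [h3] with z hz
    simp only [Function.uncurry, norm_smul]
    by_cases hx : z.1 ∈ Metric.closedBall 0 (R' + R)
    · rw [Set.indicator_of_mem hx]
      exact mul_le_mul_of_nonneg_right (hM _) (norm_nonneg _)
    · have : u (z.1 - z.2) = 0 := by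
        by_contra hne
        have := hR' (subset_tsupport u hne)
        rw [mem_closedBall_zero_iff] at this hx
        have h4 := norm_add_le (z.1 - z.2) z.2
        rw [sub_add_cancel] at h4
        linarith
      simp [this, Set.indicator_of_notMem hx]

/-- Iterated difference quotients of a weakly differentiable function are averages of
translates of its weak derivative. -/
lemma exists_backDiff_ae_eq_average (h : ℝ) (ρ : Fin d → ℕ) :
    ∃ μ : Measure (EuclideanSpace ℝ (Fin d)), IsProbabilityMeasure μ ∧
      (∀ᵐ y ∂μ, ‖y‖ ≤ (∑ t, ρ t : ℕ) * |h|) ∧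
      ∀ (p : ℝ≥0∞), 1 ≤ p → p ≠ ⊤ → ∀ f g : EuclideanSpace ℝ (Fin d) → ℂ, MemLp f p volume →
        MemLp g p volume → StronglyMeasurable g → HasWeakDeriv ρ f g →
        multiPow (backDiff h) ρ f =ᵐ[volume]
          fun x => (h ^ (∑ t, ρ t)) • ∫ y, g (x + y) ∂μ := by
  -- The step is `-h` because the differences are moved to the test function. The sign `(-1)^{|ρ|}`
  -- thus produced cancels the one in the definition of the weak derivative.
  obtain ⟨μ, hμ, hsupp, hform⟩ := exists_foldl_backDiff_eq_integral (-h) (coordList ρ)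
  rw [length_coordList] at hsupp hform
  refine ⟨μ, hμ, by simpa using hsupp, fun p hp hp_top f g hf hg hgm hfg => ?_⟩
  have hav := memLp_average (μ := μ) hp hp_top hgm hg
  rw [multiPow_eq_foldr]
  refine ae_eq_of_integral_contDiff_smul_eq
    ((MemLp.foldr_backDiff hf h _).locallyIntegrable hp)
    ((hav.1.const_smul (h ^ (∑ t, ρ t))).locallyIntegrable hp) fun u hu hc => ?_
  have hw := (contDiff_foldr_partialDeriv hu (coordList ρ)).continuous
  have hwc := hasCompactSupport_foldr_partialDeriv hc (coordList ρ)
  rw [integral_smul_foldr_backDiff hp hf h _ hu hc]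
  have hweak : ∀ y, ∫ x, (coordList ρ).foldr partialDeriv u (x - y) • f x =
      (-1 : ℝ) ^ (∑ t, ρ t) • ∫ x, u (x - y) • g x := by
    intro y
    have := hfg (fun x => u (x - y)) (hu.comp (contDiff_id.sub contDiff_const))
      (HasCompactSupport.comp_sub_const hc y)
    simpa only [multiPow_eq_foldr, foldr_partialDeriv_comp_sub] using this
  have hshift : ∀ y, ∫ x, u (x - y) • g x = ∫ x, u x • g (x + y) := by
    intro y
    rw [← integral_sub_right_eq_self (fun x => u x • g (x + y)) y]
    simp
  have hint : Integrable (Function.uncurry fun x y => u x • g (x + y)) (volume.prod μ) := by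
    have hnorm := memLp_average (μ := μ) hp hp_top hgm.norm hg.norm
    rw [integrable_prod_iff]
    · constructor
      · filter_upwards [ae_integrable_comp_add (μ := μ) hp hp_top hgm hg] with x hx
        exact hx.smul (u x)
      · have := (hnorm.1.locallyIntegrable hp).integrable_smul_left_of_hasCompactSupport
          hu.continuous hc
        refine this.norm.congr (ae_of_all _ fun x => ?_)
        have h0 : 0 ≤ ∫ y, ‖g (x + y)‖ ∂μ := integral_nonneg fun _ => norm_nonneg _
        simp only [Function.uncurry, norm_smul, integral_const_mul, Real.norm_of_nonneg h0]
    · exact ((hu.continuous.stronglyMeasurable.comp_measurable measurable_fst).smul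
        (hgm.comp_measurable measurable_add)).aestronglyMeasurable
  calc ∫ x, (coordList ρ).foldl (fun v t => backDiff (-h) t v) u x • f x
      = ∫ x, (-h) ^ (∑ t, ρ t) •
          ∫ y, (coordList ρ).foldr partialDeriv u (x - y) • f x ∂μ := by
        simp only [hform u hu hc, integral_smul_const, smul_smul]
    _ = (-h) ^ (∑ t, ρ t) •
          ∫ y, (∫ x, (coordList ρ).foldr partialDeriv u (x - y) • f x) ∂μ := by
        rw [integral_smul, integral_integral_swap
          (integrable_prod_smul_comp_sub hp hf hw hwc hsupp)]
    _ = h ^ (∑ t, ρ t) • ∫ y, (∫ x, u x • g (x + y)) ∂μ := by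
        simp only [hweak, hshift, integral_smul, smul_smul, ← mul_pow, mul_neg, mul_one, neg_neg]
    _ = h ^ (∑ t, ρ t) • ∫ x, (∫ y, u x • g (x + y) ∂μ) := by
        rw [integral_integral_swap hint]
    _ = _ := by
        simp only [integral_smul, smul_comm _ (h ^ (∑ t, ρ t))]

end AffineAnalysis

/-! ### The analysis operator: commutation with differences and uniform boundedness. -/

namespace AffineAnalysis

variable {d : ℕ} {p q : ℝ≥0∞} {α : ℝ} {φ : EuclideanSpace ℝ (Fin d) → ℂ}

section Dilation

lemma measurableEmbedding_smul_sub (hα : α ≠ 0) (v : EuclideanSpace ℝ (Fin d)) :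
    MeasurableEmbedding fun x : EuclideanSpace ℝ (Fin d) => α • x - v :=
  ((Homeomorph.smulOfNeZero α hα).trans (Homeomorph.subRight v)).measurableEmbedding

lemma map_smul_sub_volume (hα : α ≠ 0) (v : EuclideanSpace ℝ (Fin d)) :
    (volume : Measure (EuclideanSpace ℝ (Fin d))).map (fun x => α • x - v) =
      ENNReal.ofReal (|α| ^ d)⁻¹ • volume := by
  have h : (fun x : EuclideanSpace ℝ (Fin d) => α • x - v) = (fun x => x - v) ∘ fun x => α • x :=
    rfl
  rw [h, ← Measure.map_map (by fun_prop) (by fun_prop), Measure.map_addHaar_smul _ hα,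
    Measure.map_smul, (measurePreserving_sub_right volume v).map_eq]
  simp [abs_inv, abs_pow]

lemma quasiMeasurePreserving_smul_sub (hα : α ≠ 0) (v : EuclideanSpace ℝ (Fin d)) :
    Measure.QuasiMeasurePreserving (fun x : EuclideanSpace ℝ (Fin d) => α • x - v)
      volume volume :=
  ⟨(measurableEmbedding_smul_sub hα v).measurable, by
    rw [map_smul_sub_volume hα v]; exact Measure.smul_absolutelyContinuous⟩

lemma lintegral_comp_smul_sub (hα : α ≠ 0) (v : EuclideanSpace ℝ (Fin d))
    (F : EuclideanSpace ℝ (Fin d) → ℝ≥0∞) :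
    ∫⁻ x, F (α • x - v) = ENNReal.ofReal (|α| ^ d)⁻¹ * ∫⁻ x, F x := by
  rw [← (measurableEmbedding_smul_sub hα v).lintegral_map, map_smul_sub_volume hα v,
    lintegral_smul_measure, smul_eq_mul]

lemma integral_comp_smul_sub (hα : α ≠ 0) (v : EuclideanSpace ℝ (Fin d))
    (F : EuclideanSpace ℝ (Fin d) → ℂ) :
    ∫ x, F (α • x - v) = (|α| ^ d)⁻¹ • ∫ x, F x := by
  rw [← (measurableEmbedding_smul_sub hα v).integral_map, map_smul_sub_volume hα v,
    integral_smul_measure, ENNReal.toReal_ofReal (by positivity)]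

end Dilation

section SeqNorm

lemma seqNorm_eq_eLpNorm (hp : 1 ≤ p) (hp_top : p ≠ ⊤) (s : (Fin d → ℤ) → ℂ) :
    seqNorm p s = eLpNorm s p Measure.count := by
  rw [eLpNorm_eq_lintegral_rpow_enorm_toReal (zero_lt_one.trans_le hp).ne' hp_top,
    lintegral_count, seqNorm]

lemma seqNorm_rpow (hp : 1 ≤ p) (hp_top : p ≠ ⊤) (s : (Fin d → ℤ) → ℂ) :
    seqNorm p s ^ p.toReal = ∑' k, ‖s k‖ₑ ^ p.toReal := by
  rw [seqNorm_eq_eLpNorm hp hp_top, eLpNorm_rpow_toReal hp hp_top, lintegral_count]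

lemma seqNorm_add_le (hp : 1 ≤ p) (hp_top : p ≠ ⊤) (s s' : (Fin d → ℤ) → ℂ) :
    seqNorm p (s + s') ≤ seqNorm p s + seqNorm p s' := by
  simp only [seqNorm_eq_eLpNorm hp hp_top]
  exact eLpNorm_add_le Measurable.of_discrete.aestronglyMeasurable
    Measurable.of_discrete.aestronglyMeasurable hp

lemma seqNorm_smul (hp : 1 ≤ p) (hp_top : p ≠ ⊤) (c : ℝ) (s : (Fin d → ℤ) → ℂ) :
    seqNorm p (c • s) = ‖c‖ₑ * seqNorm p s := by
  simp only [seqNorm_eq_eLpNorm hp hp_top, eLpNorm_const_smul]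

end SeqNorm

lemma memLp_rescale (hα : α ≠ 0) (hφ : MemLp φ q volume) (k : Fin d → ℤ) :
    MemLp (rescale q φ α k) q volume := by
  have h : MemLp (fun x => φ (α • x - latticePoint k)) q volume := by
    have := (measurableEmbedding_smul_sub hα (latticePoint k)).memLp_map_measure_iff
      (g := φ) (p := q) (μ := volume)
    refine this.1 ?_
    rw [map_smul_sub_volume hα]
    exact hφ.smul_measure ENNReal.ofReal_ne_top
  exact MemLp.const_smul (𝕜 := ℝ) h _

variable [ENNReal.HolderConjugate p q]

lemma integrable_mul_conj_rescale (hα : α ≠ 0) (hφ : MemLp φ q volume)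
    {f : EuclideanSpace ℝ (Fin d) → ℂ} (hf : MemLp f p volume) (k : Fin d → ℤ) :
    Integrable fun x => f x * (starRingEnd ℂ) (rescale q φ α k x) :=
  hf.integrable_mul (memLp_rescale hα hφ k).star

lemma analysis_sub (hα : α ≠ 0) (hφ : MemLp φ q volume)
    {f g : EuclideanSpace ℝ (Fin d) → ℂ} (hf : MemLp f p volume) (hg : MemLp g p volume) :
    analysis q φ α (f - g) = analysis q φ α f - analysis q φ α g := by
  funext k
  simp only [analysis, Pi.sub_apply, sub_mul]
  exact integral_sub (integrable_mul_conj_rescale hα hφ hf k)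
    (integrable_mul_conj_rescale hα hφ hg k)

lemma analysis_congr_ae {f g : EuclideanSpace ℝ (Fin d) → ℂ} (h : f =ᵐ[volume] g) :
    analysis q φ α f = analysis q φ α g := by
  funext k
  refine integral_congr_ae ?_
  filter_upwards [h] with x hx
  rw [hx]

lemma analysis_smul (c : ℝ) (f : EuclideanSpace ℝ (Fin d) → ℂ) :
    analysis q φ α (c • f) = c • analysis q φ α f := by
  funext k
  simp only [analysis, Pi.smul_apply, smul_mul_assoc, integral_smul]

lemma latticePoint_sub_single (k : Fin d → ℤ) (t : Fin d) :
    latticePoint (k - Pi.single t 1) = latticePoint k - EuclideanSpace.single t 1 := by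
  ext s
  by_cases h : s = t
  · subst h; simp [latticePoint]
  · simp [latticePoint, h]

/-- Since `α (x - α⁻¹ e_t) - (k - e_t) = α x - k`, a shift of the index is absorbed by a translation
of `f`. -/
lemma diffOp_analysis (hα : α ≠ 0) (hφ : MemLp φ q volume) (t : Fin d)
    {f : EuclideanSpace ℝ (Fin d) → ℂ} (hf : MemLp f p volume) :
    diffOp t (analysis q φ α f) = analysis q φ α (backDiff α⁻¹ t f) := by
  have h := analysis_sub hα hφ hf
    (MemLp.comp_sub_const hf (α⁻¹ • EuclideanSpace.single t (1 : ℝ)))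
  refine Eq.trans ?_ h.symm
  funext k
  simp only [diffOp, Pi.sub_apply]
  congr 1
  simp only [analysis]
  refine (integral_sub_right_eq_self _ (α⁻¹ • EuclideanSpace.single t (1 : ℝ))).symm.trans ?_
  refine integral_congr_ae (ae_of_all _ fun x => ?_)
  simp only [rescale, latticePoint_sub_single, smul_sub, smul_inv_smul₀ hα]
  congr 4
  abel

lemma multiPow_diffOp_analysis (hα : α ≠ 0) (hφ : MemLp φ q volume) (ρ : Fin d → ℕ)
    {f : EuclideanSpace ℝ (Fin d) → ℂ} (hf : MemLp f p volume) :
    multiPow diffOp ρ (analysis q φ α f) = analysis q φ α (multiPow (backDiff α⁻¹) ρ f) := by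
  simp only [multiPow_eq_foldr]
  induction coordList ρ with
  | nil => rfl
  | cons t l ih =>
    rw [List.foldr_cons, ih, diffOp_analysis hα hφ t (MemLp.foldr_backDiff hf _ l),
      List.foldr_cons]

/-- The identity `p/q = p - 1`, written so that it also covers `p = 1`, `q = ∞`. -/
lemma toReal_one_div_mul_toReal (hp : 1 ≤ p) (hp_top : p ≠ ⊤) :
    (1 / q).toReal * p.toReal = p.toReal - 1 := by
  have h : (p⁻¹ + q⁻¹).toReal = 1 := by
    rw [ENNReal.HolderConjugate.inv_add_inv_eq_one p q]; simp
  have hp0 := zero_lt_one.trans_le (one_le_toReal hp hp_top)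
  have hq : q⁻¹ ≠ ⊤ := by
    rw [ENNReal.inv_ne_top]
    exact (ENNReal.HolderConjugate.pos q p).ne'
  rw [ENNReal.toReal_add (by simpa using (zero_lt_one.trans_le hp).ne') hq,
    ENNReal.toReal_inv] at h
  rw [one_div]
  have : q⁻¹.toReal = 1 - p.toReal⁻¹ := by linarith
  rw [this]
  field_simp

/-- The analysis operator is bounded from `L^p` to `ℓ^p`, uniformly in the dilation. -/
lemma seqNorm_analysis_le (hp : 1 ≤ p) (hp_top : p ≠ ⊤) (hα : α ≠ 0) (hφ : Integrable φ)
    {f : EuclideanSpace ℝ (Fin d) → ℂ} (hf : MemLp f p volume) :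
    seqNorm p (analysis q φ α f) ≤
      ((∫⁻ x, ‖φ x‖ₑ) ^ (p.toReal - 1) * essSup (periodizationAbs φ) volume) ^ (1 / p.toReal) *
        eLpNorm f p volume := by
  have hr := one_le_toReal hp hp_top
  have hs := toReal_one_div_mul_toReal (q := q) hp hp_top
  set r := p.toReal with hrdef
  set s := (1 / q).toReal
  have hr0 : 0 < r := by linarith
  set a : ℝ := |α| ^ d
  have ha : 0 < a := by positivity
  set Φ := ∫⁻ x, ‖φ x‖ₑ
  have hΦ : Φ < ⊤ := hφ.2
  set M := essSup (periodizationAbs φ) volume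
  have hφm : ∀ k : Fin d → ℤ, AEMeasurable (fun x => ‖φ (α • x - latticePoint k)‖ₑ) volume :=
    fun k => hφ.1.enorm.comp_quasiMeasurePreserving (quasiMeasurePreserving_smul_sub hα _)
  have hmass : ∀ k : Fin d → ℤ,
      ∫⁻ x, ‖φ (α • x - latticePoint k)‖ₑ = ENNReal.ofReal a⁻¹ * Φ := fun k =>
    lintegral_comp_smul_sub hα _ fun x => ‖φ x‖ₑ
  -- The factor `|α|^{d/q}` raised to the power `p` is `|α|^{d(p-1)}`, exactly compensating the
  -- power `p - 1` of the Jacobian that Jensen's inequality produces. This makes the bound uniform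
  -- in `α`.
  have hscale : ENNReal.ofReal (a ^ s) ^ r * ENNReal.ofReal a⁻¹ ^ (r - 1) = 1 := by
    rw [ENNReal.ofReal_rpow_of_nonneg (by positivity) hr0.le,
      ENNReal.ofReal_rpow_of_nonneg (by positivity) (by linarith),
      ← ENNReal.ofReal_mul (by positivity), ← Real.rpow_mul ha.le, hs, Real.inv_rpow ha.le,
      mul_inv_cancel₀ (by positivity), ENNReal.ofReal_one]
  have hk : ∀ k : Fin d → ℤ, ‖analysis q φ α f k‖ₑ ^ r ≤
      Φ ^ (r - 1) * ∫⁻ x, ‖φ (α • x - latticePoint k)‖ₑ * ‖f x‖ₑ ^ r := by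
    intro k
    set w : EuclideanSpace ℝ (Fin d) → ℝ≥0∞ := fun x => ‖φ (α • x - latticePoint k)‖ₑ
    -- Jensen's inequality is applied to the finite measure `|φ(αx - k)| dx`; summing the outcome
    -- over `k` rebuilds the periodization at `αx`.
    set ν := (volume : Measure (EuclideanSpace ℝ (Fin d))).withDensity w
    have hν : ν Set.univ = ENNReal.ofReal a⁻¹ * Φ := by
      rw [withDensity_apply _ MeasurableSet.univ, Measure.restrict_univ, ← hmass k]
    have hfin : IsFiniteMeasure ν :=
      ⟨by rw [hν]; exact ENNReal.mul_lt_top ENNReal.ofReal_lt_top hΦ⟩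
    have hfν : AEMeasurable (fun x => ‖f x‖ₑ) ν :=
      hf.1.enorm.mono_ac (withDensity_absolutelyContinuous _ _)
    have h1 : ‖analysis q φ α f k‖ₑ ≤ ENNReal.ofReal (a ^ s) * ∫⁻ x, ‖f x‖ₑ ∂ν := by
      refine (enorm_integral_le_lintegral_enorm _).trans_eq ?_
      rw [lintegral_withDensity_eq_lintegral_mul₀ (hφm k) hf.1.enorm,
        ← lintegral_const_mul' _ _ ENNReal.ofReal_ne_top]
      refine lintegral_congr fun x => ?_
      rw [enorm_mul, RCLike.enorm_conj, rescale, enorm_smul,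
        Real.enorm_of_nonneg (by positivity), Pi.mul_apply]
      ring
    calc ‖analysis q φ α f k‖ₑ ^ r
        ≤ ENNReal.ofReal (a ^ s) ^ r * (∫⁻ x, ‖f x‖ₑ ∂ν) ^ r := by
          rw [← ENNReal.mul_rpow_of_nonneg _ _ hr0.le]
          exact ENNReal.rpow_le_rpow h1 hr0.le
      _ ≤ ENNReal.ofReal (a ^ s) ^ r *
            (ν Set.univ ^ (r - 1) * ∫⁻ x, ‖f x‖ₑ ^ r ∂ν) := by
          gcongr
          exact rpow_lintegral_le ν hr hfν
      _ = ENNReal.ofReal (a ^ s) ^ r * ENNReal.ofReal a⁻¹ ^ (r - 1) *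
            (Φ ^ (r - 1) * ∫⁻ x, ‖f x‖ₑ ^ r ∂ν) := by
          rw [hν, ENNReal.mul_rpow_of_nonneg _ _ (by linarith)]
          ring
      _ = _ := by
          rw [hscale, one_mul, lintegral_withDensity_eq_lintegral_mul₀ (hφm k)
            (hf.1.enorm.pow_const _)]
          rfl
  have hP : ∀ᵐ x : EuclideanSpace ℝ (Fin d), periodizationAbs φ (α • x) ≤ M := by
    have := (quasiMeasurePreserving_smul_sub hα (0 : EuclideanSpace ℝ (Fin d))).ae
      (ae_le_essSup (f := periodizationAbs φ))
    simpa using this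
  have hsum : seqNorm p (analysis q φ α f) ^ r ≤ Φ ^ (r - 1) * M * eLpNorm f p volume ^ r := by
    rw [seqNorm_rpow hp hp_top, eLpNorm_rpow_toReal hp hp_top]
    calc ∑' k, ‖analysis q φ α f k‖ₑ ^ r
        ≤ ∑' k : Fin d → ℤ,
            Φ ^ (r - 1) * ∫⁻ x, ‖φ (α • x - latticePoint k)‖ₑ * ‖f x‖ₑ ^ r :=
          ENNReal.tsum_le_tsum hk
      _ = Φ ^ (r - 1) * ∫⁻ x, periodizationAbs φ (α • x) * ‖f x‖ₑ ^ r := by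
          have hm : ∀ k : Fin d → ℤ,
              AEMeasurable (fun x => ‖φ (α • x - latticePoint k)‖ₑ * ‖f x‖ₑ ^ r) volume :=
            fun k => (hφm k).mul (hf.1.enorm.pow_const _)
          rw [ENNReal.tsum_mul_left, ← lintegral_tsum hm]
          simp only [ENNReal.tsum_mul_right, periodizationAbs]
      _ ≤ Φ ^ (r - 1) * ∫⁻ x, M * ‖f x‖ₑ ^ r := by
          gcongr 1
          refine lintegral_mono_ae ?_
          filter_upwards [hP] with x hx
          gcongr
      _ = _ := by
          rw [lintegral_const_mul'' _ (hf.1.enorm.pow_const _), mul_assoc]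
  have := ENNReal.rpow_le_rpow hsum (z := 1 / r) (by positivity)
  rwa [← ENNReal.rpow_mul, mul_one_div_cancel hr0.ne', ENNReal.rpow_one,
    ENNReal.mul_rpow_of_nonneg _ _ (by positivity), ← ENNReal.rpow_mul,
    mul_one_div_cancel hr0.ne', ENNReal.rpow_one] at this

end AffineAnalysis

/-! ### Step functions built from the coefficients, and the asymptotic lower bound. -/

namespace AffineAnalysis

variable {d : ℕ} {p q : ℝ≥0∞} {φ : EuclideanSpace ℝ (Fin d) → ℂ}

/-- The coordinatewise integer part. -/
noncomputable def floorVec (x : EuclideanSpace ℝ (Fin d)) : Fin d → ℤ := fun t => ⌊x t⌋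

lemma measurable_floorVec : Measurable (floorVec (d := d)) :=
  measurable_pi_lambda _ fun t => Int.measurable_floor.comp (by fun_prop)

lemma map_floorVec_singleton (k : Fin d → ℤ) :
    (volume : Measure (EuclideanSpace ℝ (Fin d))).map floorVec {k} = 1 := by
  rw [Measure.map_apply measurable_floorVec (measurableSet_singleton k)]
  have h : floorVec ⁻¹' {k} = (WithLp.ofLp : EuclideanSpace ℝ (Fin d) → Fin d → ℝ) ⁻¹'
      Set.univ.pi fun t => Set.Ico (k t : ℝ) (k t + 1) := by
    ext x
    simp [floorVec, funext_iff, Int.floor_eq_iff]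
  rw [h, (PiLp.volume_preserving_ofLp (Fin d)).measure_preimage
    (MeasurableSet.univ_pi fun t => measurableSet_Ico).nullMeasurableSet, Real.volume_pi_Ico]
  simp

lemma lintegral_comp_floorVec (F : (Fin d → ℤ) → ℝ≥0∞) :
    ∫⁻ x, F (floorVec x) = ∑' k, F k := by
  rw [← lintegral_map (f := F) Measurable.of_discrete measurable_floorVec, lintegral_countable']
  simp only [map_floorVec_singleton, mul_one]

lemma norm_latticePoint_floorVec_sub_le (x : EuclideanSpace ℝ (Fin d)) :
    ‖latticePoint (floorVec x) - x‖ ≤ √d := by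
  rw [EuclideanSpace.norm_eq]
  refine Real.sqrt_le_sqrt ?_
  refine (Finset.sum_le_card_nsmul _ _ 1 fun t _ => ?_).trans_eq (by simp)
  have h1 := Int.floor_le (x t)
  have h2 := Int.lt_floor_add_one (x t)
  have : ‖(latticePoint (floorVec x) - x) t‖ ≤ 1 := by
    simp only [latticePoint, floorVec, PiLp.sub_apply, Real.norm_eq_abs, abs_le]
    constructor <;> linarith
  exact pow_le_one₀ (norm_nonneg _) this

/-- The step function on the cells of `α⁻¹ ℤ^d` whose values are the normalized analysis
coefficients of `g`. -/
noncomputable def stepFun (p q : ℝ≥0∞) (φ : EuclideanSpace ℝ (Fin d) → ℂ) (α : ℝ)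
    (g : EuclideanSpace ℝ (Fin d) → ℂ) : EuclideanSpace ℝ (Fin d) → ℂ :=
  fun x => ((|α| ^ d) ^ (1 / p.toReal) : ℝ) • analysis q φ α g (floorVec (α • x))

lemma measurable_stepFun (α : ℝ) (g : EuclideanSpace ℝ (Fin d) → ℂ) :
    Measurable (stepFun p q φ α g) := by
  have : Measurable fun k : Fin d → ℤ =>
      ((|α| ^ d) ^ (1 / p.toReal) : ℝ) • analysis q φ α g k := Measurable.of_discrete
  exact this.comp (measurable_floorVec.comp (measurable_const_smul α))

/-- Each cell has volume `|α|^{-d}`, which the normalization `|α|^{d/p}` of the step function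
compensates. -/
lemma eLpNorm_stepFun (hp : 1 ≤ p) (hp_top : p ≠ ⊤) {α : ℝ} (hα : α ≠ 0)
    (g : EuclideanSpace ℝ (Fin d) → ℂ) :
    eLpNorm (stepFun p q φ α g) p volume = seqNorm p (analysis q φ α g) := by
  have hr0 : 0 < p.toReal := zero_lt_one.trans_le (one_le_toReal hp hp_top)
  have ha : 0 < |α| ^ d := by positivity
  have h := lintegral_comp_smul_sub hα (0 : EuclideanSpace ℝ (Fin d))
    fun z => ‖analysis q φ α g (floorVec z)‖ₑ ^ p.toReal
  simp only [sub_zero] at h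
  rw [eLpNorm_eq_lintegral_rpow_enorm_toReal (zero_lt_one.trans_le hp).ne' hp_top, seqNorm]
  congr 1
  simp only [stepFun, enorm_smul, ENNReal.mul_rpow_of_nonneg _ _ hr0.le]
  rw [lintegral_const_mul' _ _ (by simp [hr0.le]), h,
    lintegral_comp_floorVec fun k => ‖analysis q φ α g k‖ₑ ^ p.toReal, ← mul_assoc,
    Real.enorm_of_nonneg (by positivity), ENNReal.ofReal_rpow_of_nonneg (by positivity) hr0.le,
    ← ENNReal.ofReal_mul (by positivity), ← Real.rpow_mul ha.le, one_div_mul_cancel hr0.ne',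
    Real.rpow_one, mul_inv_cancel₀ ha.ne', ENNReal.ofReal_one, one_mul]

/-- The normalizations `|α|^{d/p}` and `|α|^{d/q}` multiply to `|α|^d`, which cancels the Jacobian
of `z = αy - k`. What remains is an integral against the fixed weight `conj φ`. -/
lemma stepFun_eq_integral [ENNReal.HolderConjugate p q] (hp : 1 ≤ p) (hp_top : p ≠ ⊤) {α : ℝ}
    (hα : α ≠ 0) (g : EuclideanSpace ℝ (Fin d) → ℂ) (x : EuclideanSpace ℝ (Fin d)) :
    stepFun p q φ α g x =
      ∫ z, g (α⁻¹ • (z + latticePoint (floorVec (α • x)))) * (starRingEnd ℂ) (φ z) := by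
  have hr0 : 0 < p.toReal := zero_lt_one.trans_le (one_le_toReal hp hp_top)
  have ha : 0 < |α| ^ d := by positivity
  have hs := toReal_one_div_mul_toReal (q := q) hp hp_top
  have hs' : 1 / p.toReal + (1 / q).toReal = 1 := by
    field_simp at hs ⊢
    linarith
  set k := floorVec (α • x) with hk
  have h := integral_comp_smul_sub hα (latticePoint k)
    fun z => g (α⁻¹ • (z + latticePoint k)) * (starRingEnd ℂ) (φ z)
  simp only [sub_add_cancel, inv_smul_smul₀ hα] at h
  have h2 : analysis q φ α g k = ((|α| ^ d) ^ (1 / q).toReal : ℝ) •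
      ∫ y, g y * (starRingEnd ℂ) (φ (α • y - latticePoint k)) := by
    rw [analysis, ← integral_smul]
    refine integral_congr_ae (ae_of_all _ fun y => ?_)
    simp only [rescale, Complex.real_smul, map_mul, Complex.conj_ofReal]
    ring
  rw [stepFun, ← hk, h2, h, smul_smul, smul_smul, ← Real.rpow_add ha, hs', Real.rpow_one,
    mul_inv_cancel₀ ha.ne', one_smul]

/-- Dominated convergence with majorant `M |φ|`: the point at which `g` is evaluated lies within
`|α_j|⁻¹ (‖z‖ + √d)` of `x`, where `√d` bounds the rounding error of the integer part. -/
lemma tendsto_stepFun [ENNReal.HolderConjugate p q] (hp : 1 ≤ p) (hp_top : p ≠ ⊤)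
    (hφ : Integrable φ) (hφ_int : ∫ x, φ x = 1) {α : ℕ → ℝ}
    (hα : Tendsto (fun j => |α j|) atTop atTop) {g : EuclideanSpace ℝ (Fin d) → ℂ}
    (hg : Continuous g) (hgc : HasCompactSupport g) (x : EuclideanSpace ℝ (Fin d)) :
    Tendsto (fun j => stepFun p q φ (α j) g x) atTop (𝓝 (g x)) := by
  have hne : ∀ᶠ j in atTop, α j ≠ 0 := by
    filter_upwards [hα.eventually_gt_atTop 0] with j hj using abs_pos.1 hj
  have hlim : ∫ z, g x * (starRingEnd ℂ) (φ z) = g x := by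
    rw [integral_const_mul, integral_conj, hφ_int, map_one, mul_one]
  have hmain : Tendsto (fun j => ∫ z, g ((α j)⁻¹ • (z + latticePoint (floorVec (α j • x)))) *
      (starRingEnd ℂ) (φ z)) atTop (𝓝 (∫ z, g x * (starRingEnd ℂ) (φ z))) := by
    obtain ⟨M, hM⟩ := hg.bounded_above_of_compact_support hgc
    refine tendsto_integral_of_dominated_convergence (fun z => M * ‖φ z‖) (fun j => ?_)
      (hφ.norm.const_mul M) (fun j => ae_of_all _ fun z => ?_) (ae_of_all _ fun z => ?_)
    · exact (Continuous.aestronglyMeasurable (by fun_prop)).mul hφ.1.star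
    · rw [norm_mul, RCLike.norm_conj]
      exact mul_le_mul_of_nonneg_right (hM _) (norm_nonneg _)
    · refine Tendsto.mul_const _ ((hg.tendsto x).comp ?_)
      rw [tendsto_iff_norm_sub_tendsto_zero]
      have hb : Tendsto (fun j => |α j|⁻¹ * (‖z‖ + √d)) atTop (𝓝 0) := by
        simpa using hα.inv_tendsto_atTop.mul_const (‖z‖ + √d)
      refine squeeze_zero' (Eventually.of_forall fun _ => norm_nonneg _) ?_ hb
      filter_upwards [hne] with j hj
      have : (α j)⁻¹ • (z + latticePoint (floorVec (α j • x))) - x =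
          (α j)⁻¹ • (z + (latticePoint (floorVec (α j • x)) - α j • x)) := by
        rw [← add_sub_assoc, smul_sub, inv_smul_smul₀ hj]
      rw [this, norm_smul, norm_inv, Real.norm_eq_abs]
      gcongr
      exact (norm_add_le _ _).trans (by gcongr; exact norm_latticePoint_floorVec_sub_le _)
  rw [hlim] at hmain
  refine hmain.congr' ?_
  filter_upwards [hne] with j hj
  rw [stepFun_eq_integral hp hp_top hj]

/-- Fatou's lemma for the step functions. -/
lemma eLpNorm_le_liminf_seqNorm_analysis [ENNReal.HolderConjugate p q] (hp : 1 ≤ p)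
    (hp_top : p ≠ ⊤) (hφ : Integrable φ) (hφ_int : ∫ x, φ x = 1) {α : ℕ → ℝ}
    (hα : Tendsto (fun j => |α j|) atTop atTop) {g : EuclideanSpace ℝ (Fin d) → ℂ}
    (hg : Continuous g) (hgc : HasCompactSupport g) :
    eLpNorm g p volume ≤ liminf (fun j => seqNorm p (analysis q φ (α j) g)) atTop := by
  have h := Lp.eLpNorm_lim_le_liminf_eLpNorm (p := p) (μ := volume)
    (f := fun j => stepFun p q φ (α j) g)
    (fun j => (measurable_stepFun (α j) g).aestronglyMeasurable) g
    (ae_of_all _ fun x => tendsto_stepFun hp hp_top hφ hφ_int hα hg hgc x)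
  refine h.trans_eq (liminf_congr ?_)
  filter_upwards [hα.eventually_gt_atTop 0] with j hj
  exact eLpNorm_stepFun hp hp_top (abs_pos.1 hj) g

/-- The `L^p` norm is asymptotically dominated by the `ℓ^p` norms of analysis coefficients,
along any convergent sequence in `L^p`. -/
lemma eventually_eLpNorm_le_seqNorm_analysis_add [ENNReal.HolderConjugate p q] (hp : 1 ≤ p)
    (hp_top : p ≠ ⊤) (hφ : Integrable φ) (hφq : MemLp φ q volume)
    (hPφ : essSup (periodizationAbs φ) volume < ⊤)
    (hφ_int : ∫ x, φ x = 1) {α : ℕ → ℝ} (hα : Tendsto (fun j => |α j|) atTop atTop)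
    {g : EuclideanSpace ℝ (Fin d) → ℂ} (hg : MemLp g p volume)
    {G : ℕ → EuclideanSpace ℝ (Fin d) → ℂ} (hG : ∀ᶠ j in atTop, MemLp (G j) p volume)
    (hGg : Tendsto (fun j => eLpNorm (G j - g) p volume) atTop (𝓝 0)) {ε : ℝ≥0∞} (hε : ε ≠ 0) :
    ∀ᶠ j in atTop, eLpNorm g p volume ≤ seqNorm p (analysis q φ (α j) (G j)) + ε := by
  obtain ⟨C, hC, hbound⟩ : ∃ C : ℝ≥0∞, C ≠ ⊤ ∧ ∀ β : ℝ, β ≠ 0 →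
      ∀ f : EuclideanSpace ℝ (Fin d) → ℂ, MemLp f p volume →
        seqNorm p (analysis q φ β f) ≤ C * eLpNorm f p volume := by
    refine ⟨_, ?_, fun β hβ f hf => seqNorm_analysis_le hp hp_top hβ hφ hf⟩
    have hr := one_le_toReal hp hp_top
    refine ENNReal.rpow_ne_top_of_nonneg (by positivity) (ENNReal.mul_ne_top ?_ hPφ.ne)
    exact ENNReal.rpow_ne_top_of_nonneg (by linarith) hφ.2.ne
  -- Error budget: one `δ` for replacing `g` by a continuous `g'`, one for passing from the liminf
  -- to a fixed `j`, and `C (δ + δ)` for replacing `g'` by `G j` inside the analysis operator.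
  obtain ⟨δ, hδ0, hδ⟩ : ∃ δ : ℝ≥0∞, δ ≠ 0 ∧ δ + δ + C * (δ + δ) ≤ ε := by
    have hc : Tendsto (fun δ : ℝ≥0∞ => δ + δ + C * (δ + δ)) (𝓝 0) (𝓝 (0 + 0 + C * (0 + 0))) := by
      have h1 : Tendsto (fun δ : ℝ≥0∞ => δ + δ) (𝓝 0) (𝓝 (0 + 0)) := tendsto_id.add tendsto_id
      exact h1.add (ENNReal.Tendsto.const_mul h1 (Or.inr hC))
    simp only [add_zero, mul_zero] at hc
    have h1 := (hc.eventually (ge_mem_nhds (pos_iff_ne_zero.2 hε))).filter_mono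
      (nhdsWithin_le_nhds (s := Set.Ioi 0))
    obtain ⟨δ, h2, h3⟩ := (h1.and self_mem_nhdsWithin).exists
    exact ⟨δ, (Set.mem_Ioi.1 h3).ne', h2⟩
  obtain ⟨g', hgc', hgg', hg'cont, hg'p⟩ := hg.exists_hasCompactSupport_eLpNorm_sub_le hp_top hδ0
  have hlim := eLpNorm_le_liminf_seqNorm_analysis (q := q) hp hp_top hφ hφ_int hα hg'cont hgc'
  have hg'ev : ∀ᶠ j in atTop, eLpNorm g' p volume ≤ seqNorm p (analysis q φ (α j) g') + δ := by
    -- Subtracting `δ` gives a strictly smaller number only when the norm is nonzero; the zero case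
    -- is trivial.
    by_cases h0 : eLpNorm g' p volume = 0
    · simp [h0]
    have hlt := (ENNReal.sub_lt_self hg'p.2.ne h0 hδ0).trans_le hlim
    filter_upwards [eventually_lt_of_lt_liminf hlt] with j hj
    exact tsub_le_iff_right.1 hj.le
  filter_upwards [hg'ev, hG, hGg.eventually (ge_mem_nhds (pos_iff_ne_zero.2 hδ0)),
    hα.eventually_gt_atTop 0] with j hj hGj hjδ hαj
  have hα0 : α j ≠ 0 := abs_pos.1 hαj
  have hdist : eLpNorm (g' - G j) p volume ≤ δ + δ := by
    have h1 : g' - G j = (g' - g) + (g - G j) := by abel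
    rw [h1]
    refine (eLpNorm_add_le (hg'p.sub hg).1 (hg.sub hGj).1 hp).trans ?_
    rw [eLpNorm_sub_comm g', eLpNorm_sub_comm g (G j)]
    gcongr
  have hT : seqNorm p (analysis q φ (α j) g') ≤
      seqNorm p (analysis q φ (α j) (G j)) + C * (δ + δ) := by
    have h1 : analysis q φ (α j) g' =
        analysis q φ (α j) (G j) + analysis q φ (α j) (g' - G j) := by
      rw [analysis_sub hα0 hφq hg'p hGj]; abel
    rw [h1]
    refine (seqNorm_add_le hp hp_top _ _).trans ?_
    gcongr
    exact (hbound _ hα0 _ (hg'p.sub hGj)).trans (by gcongr)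
  have hsplit : eLpNorm g p volume ≤ eLpNorm g' p volume + δ := by
    have h1 : g = g' + (g - g') := by abel
    calc eLpNorm g p volume = eLpNorm (g' + (g - g')) p volume := by rw [← h1]
      _ ≤ eLpNorm g' p volume + eLpNorm (g - g') p volume :=
        eLpNorm_add_le hg'p.1 (hg.sub hg'p).1 hp
      _ ≤ _ := by gcongr
  calc eLpNorm g p volume ≤ eLpNorm g' p volume + δ := hsplit
    _ ≤ seqNorm p (analysis q φ (α j) g') + δ + δ := by gcongr
    _ ≤ seqNorm p (analysis q φ (α j) (G j)) + C * (δ + δ) + δ + δ := by gcongr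
    _ = seqNorm p (analysis q φ (α j) (G j)) + (δ + δ + C * (δ + δ)) := by ring
    _ ≤ _ := by gcongr

/-- Continuity of translations in `L^p`. -/
lemma exists_forall_eLpNorm_comp_add_sub_le (hp : 1 ≤ p) (hp_top : p ≠ ⊤)
    {g : EuclideanSpace ℝ (Fin d) → ℂ} (hg : MemLp g p volume) {ε : ℝ≥0∞} (hε : ε ≠ 0) :
    ∃ δ > 0, ∀ y, ‖y‖ ≤ δ → eLpNorm (fun x => g (x + y) - g x) p volume ≤ ε := by
  have : Fact (1 ≤ p) := ⟨hp⟩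
  let τ : C(EuclideanSpace ℝ (Fin d), C(EuclideanSpace ℝ (Fin d), EuclideanSpace ℝ (Fin d))) :=
    (ContinuousMap.mk (fun z : EuclideanSpace ℝ (Fin d) × EuclideanSpace ℝ (Fin d) =>
      z.2 + z.1) (by fun_prop)).curry
  have hτ : ∀ y, MeasurePreserving (τ y) volume volume := fun y =>
    measurePreserving_add_right volume y
  have h := Filter.Tendsto.compMeasurePreservingLp (f := fun _ => hg.toLp g)
    (tendsto_const_nhds (x := hg.toLp g) (f := 𝓝 0)) (τ.continuous.tendsto 0) hτ (hτ 0) hp_top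
  rw [Lp.tendsto_Lp_iff_tendsto_eLpNorm'] at h
  have h2 := h.eventually (ge_mem_nhds (pos_iff_ne_zero.2 hε))
  obtain ⟨δ, hδ, hball⟩ := Metric.nhds_basis_closedBall.mem_iff.1 h2
  refine ⟨δ, hδ, fun y hy => ?_⟩
  have h3 := hball (mem_closedBall_zero_iff.2 hy)
  refine le_of_eq_of_le (eLpNorm_congr_ae ?_) h3
  have h4 : ∀ y, Lp.compMeasurePreserving (τ y) (hτ y) (hg.toLp g) =ᵐ[volume]
      fun x => g (x + y) := fun y =>
    (Lp.coeFn_compMeasurePreserving _ (hτ y)).trans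
      ((hτ y).quasiMeasurePreserving.ae_eq_comp hg.coeFn_toLp)
  filter_upwards [h4 y, h4 0] with x hx hx0
  rw [Pi.sub_apply, hx, hx0, add_zero]

end AffineAnalysis

/-! ### Sobolev functions and the two-sided estimate. -/

namespace AffineAnalysis

variable {d m : ℕ} {p q : ℝ≥0∞} {φ : EuclideanSpace ℝ (Fin d) → ℂ}

/-- `weakDeriv` is chosen among locally integrable functions only. The fundamental lemma of the
calculus of variations identifies it almost everywhere with the `L^p` derivative supplied by
`MemSobolev`. -/
lemma MemSobolev.memLp_weakDeriv (hp : 1 ≤ p) {f : EuclideanSpace ℝ (Fin d) → ℂ}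
    (hf : MemSobolev m p f) {ρ : Fin d → ℕ} (hρ : ρ ∈ multiIndices d m) :
    MemLp (weakDeriv ρ f) p volume ∧ HasWeakDeriv ρ f (weakDeriv ρ f) := by
  obtain ⟨g, hg, hfg⟩ := hf.2 ρ hρ
  have h : ∃ g, LocallyIntegrable g volume ∧ HasWeakDeriv ρ f g :=
    ⟨g, hg.locallyIntegrable hp, hfg⟩
  have heq : weakDeriv ρ f = h.choose := by rw [weakDeriv, dif_pos h]
  obtain ⟨hloc, hweak⟩ := h.choose_spec
  rw [heq]
  refine ⟨(memLp_congr_ae ?_).2 hg, hweak⟩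
  refine ae_eq_of_integral_contDiff_smul_eq hloc (hg.locallyIntegrable hp) fun u hu hc => ?_
  have h1 := (hweak u hu hc).symm.trans (hfg u hu hc)
  exact smul_right_injective ℂ (pow_ne_zero _ (neg_ne_zero.2 (one_ne_zero (α := ℝ)))) h1

/-- The scaled differences of the analysis coefficients of `f` are the analysis coefficients of
an average of translates of the weak derivative `g`. -/
lemma exists_scaled_diff_analysis_eq [ENNReal.HolderConjugate p q] (hp : 1 ≤ p)
    (hp_top : p ≠ ⊤) (hφ : MemLp φ q volume) {β : ℝ} (hβ : β ≠ 0) {ρ : Fin d → ℕ}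
    {f g : EuclideanSpace ℝ (Fin d) → ℂ} (hf : MemLp f p volume) (hg : MemLp g p volume)
    (hgm : StronglyMeasurable g) (hfg : HasWeakDeriv ρ f g) :
    ∃ G : EuclideanSpace ℝ (Fin d) → ℂ, MemLp G p volume ∧
      eLpNorm G p volume ≤ eLpNorm g p volume ∧
      (∀ B : ℝ≥0∞, (∀ y, ‖y‖ ≤ (∑ t, ρ t : ℕ) * |β|⁻¹ →
        eLpNorm (fun x => g (x + y) - g x) p volume ≤ B) → eLpNorm (G - g) p volume ≤ B) ∧
      ‖β‖ₑ ^ (∑ t, ρ t) * seqNorm p (multiPow diffOp ρ (analysis q φ β f)) =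
        seqNorm p (analysis q φ β G) := by
  obtain ⟨μ, hμ, hsupp, hform⟩ := exists_backDiff_ae_eq_average β⁻¹ ρ
  have hav := memLp_average (μ := μ) hp hp_top hgm hg
  refine ⟨fun x => ∫ y, g (x + y) ∂μ, hav.1, hav.2, fun B hB => ?_, ?_⟩
  · refine eLpNorm_average_sub_le hp hp_top hgm hg ?_
    filter_upwards [hsupp] with y hy
    exact hB y (by rwa [abs_inv] at hy)
  · have h1 : analysis q φ β (multiPow (backDiff β⁻¹) ρ f) =
        (β⁻¹ ^ (∑ t, ρ t)) • analysis q φ β fun x => ∫ y, g (x + y) ∂μ := by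
      rw [← analysis_smul]
      exact analysis_congr_ae (hform p hp hp_top f g hf hg hgm hfg)
    rw [multiPow_diffOp_analysis hβ hφ ρ hf, h1, seqNorm_smul hp hp_top, ← mul_assoc,
      ← enorm_pow, ← enorm_mul, ← mul_pow, mul_inv_cancel₀ hβ]
    simp

/-- Each scaled difference of the analysis coefficients eventually dominates the weak
derivative, up to `ε`. -/
lemma eventually_eLpNorm_weakDeriv_le [ENNReal.HolderConjugate p q] (hp : 1 ≤ p)
    (hp_top : p ≠ ⊤) (hφ : Integrable φ) (hφq : MemLp φ q volume)
    (hPφ : essSup (periodizationAbs φ) volume < ⊤)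
    (hφ_int : ∫ x, φ x = 1) {α : ℕ → ℝ} (hα : Tendsto (fun j => |α j|) atTop atTop)
    {ρ : Fin d → ℕ} {f g : EuclideanSpace ℝ (Fin d) → ℂ} (hf : MemLp f p volume)
    (hg : MemLp g p volume) (hgm : StronglyMeasurable g) (hfg : HasWeakDeriv ρ f g)
    {ε : ℝ≥0∞} (hε : ε ≠ 0) :
    ∀ᶠ j in atTop, eLpNorm g p volume ≤
      ‖α j‖ₑ ^ (∑ t, ρ t) * seqNorm p (multiPow diffOp ρ (analysis q φ (α j) f)) + ε := by
  have hne : ∀ᶠ j in atTop, α j ≠ 0 := by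
    filter_upwards [hα.eventually_gt_atTop 0] with j hj using abs_pos.1 hj
  -- The averaging measure depends on the step `(α j)⁻¹`, so there is one average `G j` for each
  -- `j`.
  choose! G hG _ hGdist hGeq using fun (j : ℕ) (hj : α j ≠ 0) =>
    exists_scaled_diff_analysis_eq (q := q) hp hp_top hφq hj hf hg hgm hfg
  have hlim : Tendsto (fun j => eLpNorm (G j - g) p volume) atTop (𝓝 0) := by
    rw [ENNReal.tendsto_nhds_zero]
    intro η hη
    obtain ⟨δ, hδ, hcont⟩ := exists_forall_eLpNorm_comp_add_sub_le hp hp_top hg hη.ne'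
    have hr : Tendsto (fun j => ((∑ t, ρ t : ℕ) : ℝ) * |α j|⁻¹) atTop (𝓝 0) := by
      simpa using hα.inv_tendsto_atTop.const_mul ((∑ t, ρ t : ℕ) : ℝ)
    filter_upwards [hne, hr.eventually (ge_mem_nhds hδ)] with j hj hjδ
    exact hGdist j hj η fun y hy => hcont y (hy.trans hjδ)
  filter_upwards [hne, eventually_eLpNorm_le_seqNorm_analysis_add hp hp_top hφ hφq hPφ hφ_int hα
    hg (hne.mono hG) hlim hε] with j hj hle
  rwa [hGeq j hj]

end AffineAnalysis

open AffineAnalysis in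
theorem mainTheorem12 (d : ℕ) (hd : 0 < d) (m : ℕ) (p q : ℝ≥0∞) (hp : 1 ≤ p) (hp_top : p ≠ ⊤)
    (hpq : 1 / p + 1 / q = 1)
    (φ : EuclideanSpace ℝ (Fin d) → ℂ) (hφ : MemLp φ q volume)
    (hPφ : essSup (AffineAnalysis.periodizationAbs φ) volume < ⊤)
    (hφ_int : ∫ x, φ x = 1) :
    ∃ c C : ℝ≥0, 0 < c ∧ 0 < C ∧
      ∀ α : ℕ → ℝ, (∀ j, 0 < j → α j ≠ 0) → Tendsto (fun j => |α j|) atTop atTop →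
        ∀ f : EuclideanSpace ℝ (Fin d) → ℂ, AffineAnalysis.MemSobolev m p f →
          (c : ℝ≥0∞) * AffineAnalysis.sobolevNorm m p f ≤
              AffineAnalysis.discreteSobolevNorm m p α
                (fun j => AffineAnalysis.analysis q φ (α j) f) ∧
            AffineAnalysis.discreteSobolevNorm m p α
                (fun j => AffineAnalysis.analysis q φ (α j) f) ≤
              (C : ℝ≥0∞) * AffineAnalysis.sobolevNorm m p f := by
  have : ENNReal.HolderConjugate p q :=
    ENNReal.holderConjugate_iff.2 (by simpa only [one_div] using hpq)
  -- The Bochner integral of a non-integrable function is `0`, so `∫ φ = 1` already forces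
  -- integrability.
  have hφi : Integrable φ := by
    by_contra h
    rw [integral_undef h] at hφ_int
    exact zero_ne_one hφ_int
  set K : ℝ≥0∞ := ((∫⁻ x, ‖φ x‖ₑ) ^ (p.toReal - 1) * essSup (periodizationAbs φ) volume) ^
    (1 / p.toReal)
  have hK : K ≠ ⊤ := by
    have hr := one_le_toReal hp hp_top
    refine ENNReal.rpow_ne_top_of_nonneg (by positivity) (ENNReal.mul_ne_top ?_ hPφ.ne)
    exact ENNReal.rpow_ne_top_of_nonneg (by linarith) hφi.2.ne
  -- The operator bound `K` suffices for the upper estimate; adding `1` only ensures positivity.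
  refine ⟨1, K.toNNReal + 1, one_pos, by positivity, fun α hα0 hα f hf => ?_⟩
  -- The averaging measures may be singular with respect to Lebesgue measure, so an almost
  -- everywhere class is not enough: a strongly measurable representative makes `g (x + y)` jointly
  -- measurable.
  have hrep : ∀ ρ ∈ multiIndices d m, ∃ g : EuclideanSpace ℝ (Fin d) → ℂ, MemLp g p volume ∧
      StronglyMeasurable g ∧ HasWeakDeriv ρ f g ∧
      eLpNorm g p volume = eLpNorm (weakDeriv ρ f) p volume := by
    intro ρ hρ
    obtain ⟨hD, hfD⟩ := hf.memLp_weakDeriv hp hρ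
    have hae := hD.1.ae_eq_mk
    exact ⟨hD.1.mk _, (memLp_congr_ae hae).1 hD, hD.1.stronglyMeasurable_mk,
      hfD.congr_ae hae, (eLpNorm_congr_ae hae).symm⟩
  constructor
  · rw [ENNReal.coe_one, one_mul]
    refine ENNReal.le_of_forall_pos_le_add fun ε hε _ => ?_
    set N := (multiIndices d m).card
    -- The error is split evenly over the `N` multiindices; `N + 1` keeps the denominator visibly
    -- nonzero.
    have hη : (ε : ℝ≥0∞) / (N + 1) ≠ 0 := by
      simp [hε.ne', ENNReal.div_eq_zero_iff, ENNReal.add_eq_top]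
    have hev : ∀ᶠ j in atTop, ∀ ρ ∈ multiIndices d m, eLpNorm (weakDeriv ρ f) p volume ≤
        ‖α j‖ₑ ^ (∑ t, ρ t) * seqNorm p (multiPow diffOp ρ (analysis q φ (α j) f)) +
          (ε : ℝ≥0∞) / (N + 1) := by
      rw [Filter.eventually_all_finset]
      intro ρ hρ
      obtain ⟨g, hg, hgm, hfg, heq⟩ := hrep ρ hρ
      rw [← heq]
      exact eventually_eLpNorm_weakDeriv_le hp hp_top hφi hφ hPφ hφ_int hα hf.1 hg hgm hfg hη
    obtain ⟨j, hj, hj0⟩ := (hev.and (eventually_gt_atTop 0)).exists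
    refine (Finset.sum_le_sum hj).trans ?_
    rw [Finset.sum_add_distrib, Finset.sum_const, nsmul_eq_mul]
    refine add_le_add ?_ ?_
    · exact le_iSup₂_of_le (f := fun (j : ℕ) (_ : 0 < j) => ∑ ρ ∈ multiIndices d m,
        ‖α j‖ₑ ^ (∑ t, ρ t) * seqNorm p (multiPow diffOp ρ (analysis q φ (α j) f))) j hj0 le_rfl
    · rw [← mul_div_assoc]
      refine ENNReal.div_le_of_le_mul ?_
      rw [mul_comm]
      gcongr
      exact le_self_add
  · refine iSup₂_le fun j hj => ?_
    rw [sobolevNorm, Finset.mul_sum]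
    refine Finset.sum_le_sum fun ρ hρ => ?_
    obtain ⟨g, hg, hgm, hfg, heq⟩ := hrep ρ hρ
    obtain ⟨G, hG, hGle, -, hGeq⟩ :=
      exists_scaled_diff_analysis_eq (q := q) hp hp_top hφ (hα0 j hj) hf.1 hg hgm hfg
    rw [hGeq, ← heq]
    refine (seqNorm_analysis_le hp hp_top (hα0 j hj) hφi hG).trans ?_
    have hKC : K ≤ ((K.toNNReal + 1 : ℝ≥0) : ℝ≥0∞) := by
      rw [ENNReal.coe_add, ENNReal.coe_toNNReal hK]
      exact le_self_add
    exact mul_le_mul' hKC hGle
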